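/- All graphs are finite and simple. For a graph $G$, a coloring $c:V(G)\to\{1,\dots,r\}$ (not necessarily proper) is a conflict-free open neighborhood (CFON) coloring, respectively a conflict-free closed neighborhood (CFCN) coloring, if for every vertex $v$ there is a color that appears exactly once in the open neighborhood $N_G(v)$, respectively in the closed neighborhood $N_G(v)\cup\{v\}$. Let $\chi_{CF}^{ON}(G)$, respectively $\chi_{CF}^{CN}(G)$, be the minimum $r$ for which $G$ has a CFON, respectively CFCN, coloring with $r$ colors. A graph is claw-free if it has no induced subgraph isomorphic to $K_{1,3}$. Then there is an absolute constant $C>0$ such that for every claw-free graph $G$ with maximum degree $\Delta\ge 2$: (i) $\chi_{CF}^{CN}(G)\le C\ln\Delta$; and (ii) if $G$ has no isolated vertices, then $\chi_{CF}^{ON}(G)\le C\ln\Delta$. That is, $\chi_{CF}^{CN}(G)=O(\ln\Delta)$, and $\chi_{CF}^{ON}(G)=O(\ln\Delta)$ when $G$ has no isolated vertices. -/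

import Mathlib

open scoped ENNReal

namespace SimpleGraph

/-- A graph is claw-free if no induced subgraph of it is isomorphic to `K_{1,3}`. -/
def IsClawFree {V : Type*} (G : SimpleGraph V) : Prop :=
  ¬ (completeBipartiteGraph (Fin 1) (Fin 3)).IsIndContained G

/-- `c` is a conflict-free open neighborhood coloring: for every vertex `v` there is a color that
is taken by exactly one vertex of the open neighborhood of `v`. -/
def IsCFONColoring {V α : Type*} (G : SimpleGraph V) (c : V → α) : Prop :=
  ∀ v : V, ∃ i : α, ∃! w : V, w ∈ G.neighborSet v ∧ c w = i

/-- `c` is a conflict-free closed neighborhood coloring: for every vertex `v` there is a color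
that is taken by exactly one vertex of the closed neighborhood of `v`. -/
def IsCFCNColoring {V α : Type*} (G : SimpleGraph V) (c : V → α) : Prop :=
  ∀ v : V, ∃ i : α, ∃! w : V, w ∈ insert v (G.neighborSet v) ∧ c w = i

/-- The least `r` such that `G` has a CFON coloring with `r` colors (`⊤` if there is none). -/
noncomputable def cfonChromaticNumber {V : Type*} (G : SimpleGraph V) : ℕ∞ :=
  ⨅ (r : ℕ) (_ : ∃ c : V → Fin r, G.IsCFONColoring c), (r : ℕ∞)

/-- The least `r` such that `G` has a CFCN coloring with `r` colors (`⊤` if there is none). -/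
noncomputable def cfcnChromaticNumber {V : Type*} (G : SimpleGraph V) : ℕ∞ :=
  ⨅ (r : ℕ) (_ : ∃ c : V → Fin r, G.IsCFCNColoring c), (r : ℕ∞)

end SimpleGraph

/-! Let `r` be about `log₂ Δ`. In a claw-free graph an independent set meets each neighborhood at
most twice, so a union `A` of `r` successive maximal independent sets meets every neighborhood in at
most `2r` vertices, and that of each vertex outside `A` in at least `r`. Two disjoint palettes then
suffice. Vertices of `A` with a neighbor outside `A` are served from `Aᶜ`: each `u ∈ Aᶜ` is adjacent
to at most `2r` of them, so the conflicts form a `4r`-degenerate graph. Every other non-isolated `v`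
is served by the hyperedge `N(v) ∩ A`. A vertex lies in up to `2 ^ r` hyperedges of size at least
`r`, but in only `2r` possibly smaller ones, centered in `A`. A local-lemma-type counting argument
(`exists_coloring_hasUniqueColor`) colors this hypergraph with `O(r)` colors. One extra bit per
vertex passes from open to closed neighborhoods. -/

/-- Some color is taken by exactly one element of `s`. -/
def HasUniqueColor {V α : Type*} (c : V → α) (s : Finset V) : Prop :=
  ∃ i : α, ∃! w : V, w ∈ s ∧ c w = i

theorem HasUniqueColor.congr {W α : Type*} {c c' : W → α} {s : Finset W}
    (h : HasUniqueColor c s) (hcc : ∀ x ∈ s, c x = c' x) : HasUniqueColor c' s := by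
  obtain ⟨i, w, ⟨hw, hwi⟩, huniq⟩ := h
  exact ⟨i, w, ⟨hw, (hcc w hw).symm.trans hwi⟩,
    fun y hy => huniq y ⟨hy.1, (hcc y hy.1).trans hy.2⟩⟩

/-- Bounds the cost of one set of `t` representatives in a hyperedge of size `d`: `t ^ (d - t)`
copying maps, each of relative weight `2 ^ (d - t - 1) / m ^ (d - t)`. -/
theorem representatives_weight_le {m d t : ℕ} (hm : 0 < m) (hd : 64 * d ≤ m) (ht : 2 * t ≤ d)
    (hd0 : 0 < d) :
    (t : ℝ) ^ (d - t) * (2 ^ (d - t - 1) / m ^ (d - t)) ≤ 32 * d * (1 / 8) ^ d / m := by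
  have hm' : (0 : ℝ) < m := by exact_mod_cast hm
  rcases Nat.eq_zero_or_pos t with rfl | ht0
  · rw [Nat.cast_zero, zero_pow (by omega), zero_mul]; positivity
  obtain ⟨k, rfl⟩ : ∃ k, d = t + (k + 1) := ⟨d - t - 1, by omega⟩
  have e1 : t + (k + 1) - t = k + 1 := by omega
  rw [e1, Nat.add_sub_cancel]
  have hq : (2 * t : ℝ) / m ≤ 1 / 64 := by
    rw [div_le_div_iff₀ hm' (by norm_num)]
    have : 64 * (2 * t) ≤ m := by omega
    have : (64 * (2 * t) : ℝ) ≤ m := by exact_mod_cast this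
    linarith
  have h64 : ((1 : ℝ) / 64) ^ k ≤ 64 * (1 / 8) ^ (t + (k + 1)) := by
    calc ((1 : ℝ) / 64) ^ k = 64 * (1 / 8) ^ (2 * (k + 1)) := by
          rw [pow_mul, pow_succ]; norm_num; ring
      _ ≤ _ := by
          gcongr 64 * ?_
          exact pow_le_pow_of_le_one (by norm_num) (by norm_num) (by omega)
  have hdt : (2 * t : ℝ) ≤ (t + (k + 1) : ℕ) := by exact_mod_cast ht
  calc (t : ℝ) ^ (k + 1) * (2 ^ k / m ^ (k + 1))
      = 1 / 2 * ((2 * t) / m) * ((2 * t) / m) ^ k := by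
        rw [div_pow, mul_pow, pow_succ, pow_succ]; field_simp
    _ ≤ 1 / 2 * ((t + (k + 1) : ℕ) / m) * (1 / 64) ^ k := by gcongr
    _ ≤ 1 / 2 * ((t + (k + 1) : ℕ) / m) * (64 * (1 / 8) ^ (t + (k + 1))) := by gcongr
    _ = _ := by ring

/-! ### Conflict-free coloring of hypergraphs by counting -/

section Counting

variable {V ι : Type*} [DecidableEq V]

/-- If no color is unique on `s`, then the colors on `s` are determined by those on a set `T` of
at most half of the elements, which can be chosen to avoid a given element. -/
theorem exists_representatives_of_not_hasUniqueColor {α : Type*} [DecidableEq α] {c : V → α}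
    {s : Finset V} (hc : ¬ HasUniqueColor c s) (u : V) :
    ∃ T ⊆ s, u ∉ T ∧ 2 * T.card ≤ s.card ∧
      ∃ h : ↥(s \ T) → ↥T, ∀ x : ↥(s \ T), c x = c (h x) := by
  have key : ∀ i ∈ s.image c, 2 ≤ (s.filter (fun x => c x = i)).card := by
    intro i hi
    by_contra! hlt
    obtain ⟨x, hx, hxi⟩ := Finset.mem_image.1 hi
    refine hc ⟨i, x, ⟨hx, hxi⟩, fun y hy => ?_⟩
    exact Finset.card_le_one.1 (Nat.lt_succ_iff.1 hlt) y (by simpa using hy) x (by simp [hx, hxi])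
  -- Each color present occurs at least twice, so its representative can avoid `u`.
  have key2 : ∀ i ∈ s.image c, ∃ x ∈ s, c x = i ∧ x ≠ u := by
    intro i hi
    obtain ⟨x, hx, hxu⟩ := Finset.exists_mem_ne (key i hi) u
    exact ⟨x, (Finset.mem_filter.1 hx).1, (Finset.mem_filter.1 hx).2, hxu⟩
  have : Nonempty V := ⟨u⟩
  choose! g hgs hgc hgu using key2
  refine ⟨(s.image c).image g, ?_, ?_, ?_, ?_⟩
  · intro x hx
    obtain ⟨i, hi, rfl⟩ := Finset.mem_image.1 hx
    exact hgs i hi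
  · intro hx
    obtain ⟨i, hi, hu⟩ := Finset.mem_image.1 hx
    exact hgu i hi hu
  · calc 2 * ((s.image c).image g).card ≤ 2 * (s.image c).card := by
          gcongr; exact Finset.card_image_le
      _ = ∑ _i ∈ s.image c, 2 := by simp [mul_comm]
      _ ≤ ∑ i ∈ s.image c, (s.filter (fun x => c x = i)).card := Finset.sum_le_sum key
      _ = s.card := (Finset.card_eq_sum_card_image c s).symm
  · have hx : ∀ x : ↥(s \ (s.image c).image g), c x ∈ s.image c := fun x =>
      Finset.mem_image_of_mem c (Finset.mem_sdiff.1 x.2).1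
    exact ⟨fun x => ⟨g (c x), Finset.mem_image_of_mem g (hx x)⟩, fun x => (hgc _ (hx x)).symm⟩

variable [Fintype V]

open Classical in
/-- The colorings with `m` colors for which each hyperedge contained in `X` has a unique color. -/
noncomputable def goodColorings (e : ι → Finset V) (m : ℕ) (X : Finset V) :
    Finset (V → Fin m) :=
  Finset.univ.filter fun c => ∀ i, e i ⊆ X → HasUniqueColor c (e i)

theorem mem_goodColorings {e : ι → Finset V} {m : ℕ} {X : Finset V} {c : V → Fin m} :
    c ∈ goodColorings e m X ↔ ∀ i, e i ⊆ X → HasUniqueColor c (e i) := by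
  simp [goodColorings]

/-- Forcing the colors on `R` to be copies of colors outside of `R` costs a factor `m` for each
element of `R`. -/
theorem card_filter_goodColorings_mul_le (e : ι → Finset V) (m : ℕ) (X R T : Finset V)
    (hRT : Disjoint R T) (h : ↥R → ↥T) :
    ((goodColorings e m X).filter fun c => ∀ x : ↥R, c x = c (h x)).card * m ^ R.card ≤
      (goodColorings e m (X \ R)).card := by
  have hcard : m ^ R.card = (Finset.univ : Finset (↥R → Fin m)).card := by simp
  rw [hcard, ← Finset.card_product]
  -- Overwrite the colors on `R` by arbitrary ones. Edges inside `X \ R` do not notice, and the old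
  -- colors on `R` can be read off from `T`, which is untouched.
  refine Finset.card_le_card_of_injOn
    (fun p x => if hx : x ∈ R then p.2 ⟨x, hx⟩ else p.1 x) ?_ ?_
  · rintro ⟨c, z⟩ hp
    simp only [Finset.coe_product, Set.mem_prod, Finset.mem_coe, Finset.mem_filter] at hp
    rw [Finset.mem_coe, mem_goodColorings]
    intro i hi
    refine (mem_goodColorings.1 hp.1.1 i (hi.trans Finset.sdiff_subset)).congr fun x hx => ?_
    simp [(Finset.mem_sdiff.1 (hi hx)).2]
  · rintro ⟨c, z⟩ hp ⟨c', z'⟩ hp' heq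
    simp only [Finset.coe_product, Set.mem_prod, Finset.mem_coe, Finset.mem_filter] at hp hp'
    have hout : ∀ x ∉ R, c x = c' x := fun x hx => by simpa [hx] using congrFun heq x
    have hin : ∀ x : ↥R, z x = z' x := fun x => by simpa using congrFun heq x
    refine Prod.ext (funext fun x => ?_) (funext hin)
    by_cases hx : x ∈ R
    · have h1 := hp.1.2 ⟨x, hx⟩
      have h2 := hp'.1.2 ⟨x, hx⟩
      have h3 := hout _ (Finset.disjoint_right.1 hRT (h ⟨x, hx⟩).2)
      exact h1.trans (h3.trans h2.symm)
    · exact hout x hx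

theorem card_goodColorings_sdiff_le (e : ι → Finset V) (m : ℕ) (X : Finset V)
    (hX : ∀ Y ⊂ X, ∀ u ∉ Y,
      ((goodColorings e m Y).card : ℝ) ≤ 2 * (goodColorings e m (insert u Y)).card)
    (Z : Finset V) (hZ : Z ⊆ X) :
    ((goodColorings e m (X \ Z)).card : ℝ) ≤ 2 ^ Z.card * (goodColorings e m X).card := by
  induction Z using Finset.induction_on with
  | empty => simp
  | insert z Z hz ih =>
    have hzX : z ∈ X := hZ (Finset.mem_insert_self z Z)
    have hins : insert z (X \ insert z Z) = X \ Z := by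
      ext x; simp only [Finset.mem_insert, Finset.mem_sdiff]; grind
    have hss : X \ insert z Z ⊂ X := by
      refine Finset.ssubset_iff_subset_ne.2 ⟨Finset.sdiff_subset, fun h => ?_⟩
      rw [← h] at hzX
      simp at hzX
    have h1 := hX _ hss z (by simp)
    rw [hins] at h1
    have h2 := ih ((Finset.subset_insert z Z).trans hZ)
    rw [Finset.card_insert_of_notMem hz, pow_succ]
    nlinarith

-- Counting substitute for the local lemma: a coloring lost on adding `u` has a bad edge through
-- `u`, hence copies colors from few representatives. By induction such colorings are rare, and the
-- weight condition keeps the loss below one half.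
open Classical in
theorem card_goodColorings_le_two_mul [Fintype ι] (e : ι → Finset V) (m : ℕ) (hm0 : 0 < m)
    (hm : ∀ i, 64 * (e i).card ≤ m)
    (hs : ∀ u, ∑ i with u ∈ e i, 32 * (1 / 2 : ℝ) ^ (e i).card ≤ m / 2) (X : Finset V) :
    ∀ u ∉ X, ((goodColorings e m X).card : ℝ) ≤ 2 * (goodColorings e m (insert u X)).card := by
  induction X using Finset.strongInduction with
  | H X ih =>
  intro u hu
  have hm' : (0 : ℝ) < m := by exact_mod_cast hm0
  set N : ℝ := ((goodColorings e m X).card : ℝ) with hN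
  let B : ι → Finset V → Finset (V → Fin m) := fun i T =>
    Finset.univ.biUnion fun h : ↥(e i \ T) → ↥T =>
      (goodColorings e m X).filter fun c => ∀ x : ↥(e i \ T), c x = c (h x)
  let J : Finset ι := Finset.univ.filter fun i => u ∈ e i ∧ e i ⊆ insert u X
  let 𝒯 : ι → Finset (Finset V) := fun i =>
    (e i).powerset.filter fun T => u ∉ T ∧ 2 * T.card ≤ (e i).card
  have hsub : goodColorings e m X ⊆
      goodColorings e m (insert u X) ∪ J.biUnion fun i => (𝒯 i).biUnion (B i) := by
    intro c hc
    by_cases hcu : c ∈ goodColorings e m (insert u X)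
    · exact Finset.mem_union_left _ hcu
    refine Finset.mem_union_right _ ?_
    rw [mem_goodColorings] at hcu
    push Not at hcu
    obtain ⟨i, hi, hbad⟩ := hcu
    have hui : u ∈ e i := by
      by_contra hui
      exact hbad (mem_goodColorings.1 hc i ((Finset.subset_insert_iff_of_notMem hui).1 hi))
    obtain ⟨T, hT, huT, hcard, h, hh⟩ := exists_representatives_of_not_hasUniqueColor hbad u
    simp only [Finset.mem_biUnion, Finset.mem_filter, Finset.mem_univ, true_and,
      Finset.mem_powerset, J, 𝒯, B]
    exact ⟨i, ⟨hui, hi⟩, T, ⟨hT, huT, hcard⟩, h, hc, hh⟩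
  have hB : ∀ i ∈ J, ∀ T ∈ 𝒯 i,
      ((B i T).card : ℝ) ≤ 32 * (e i).card * (1 / 8) ^ (e i).card / m * N := by
    intro i hi T hT
    simp only [Finset.mem_filter, Finset.mem_univ, true_and, Finset.mem_powerset, J, 𝒯] at hi hT
    obtain ⟨hui, hiX⟩ := hi
    obtain ⟨hTe, huT, hTcard⟩ := hT
    have hkcard : (e i \ T).card = (e i).card - T.card := Finset.card_sdiff_of_subset hTe
    have hu' : u ∈ e i \ T := Finset.mem_sdiff.2 ⟨hui, huT⟩
    -- As `u ∉ X`, only `d - t - 1` vertices are really removed from `X`, while `d - t` colors are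
    -- forced; this gains the factor `1 / m`.
    have hsd : X \ (e i \ T) = X \ ((e i \ T).erase u) := by
      ext x; simp only [Finset.mem_sdiff, Finset.mem_erase]; grind
    have hle : ((goodColorings e m (X \ (e i \ T))).card : ℝ) ≤
        2 ^ ((e i).card - T.card - 1) * N := by
      rw [hsd, ← hkcard, ← Finset.card_erase_of_mem hu']
      refine card_goodColorings_sdiff_le e m X (fun Y hY => ih Y hY) _ fun x hx => ?_
      have hx' := Finset.mem_erase.1 hx
      exact (Finset.mem_insert.1 (hiX (Finset.mem_sdiff.1 hx'.2).1)).resolve_left hx'.1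
    have hone : ∀ h : ↥(e i \ T) → ↥T,
        (((goodColorings e m X).filter fun c => ∀ x : ↥(e i \ T), c x = c (h x)).card : ℝ) ≤
          2 ^ ((e i).card - T.card - 1) / m ^ ((e i).card - T.card) * N := by
      intro h
      have h1 := card_filter_goodColorings_mul_le e m X (e i \ T) T Finset.sdiff_disjoint h
      rw [hkcard] at h1
      have h2 : (((goodColorings e m X).filter
          fun c => ∀ x : ↥(e i \ T), c x = c (h x)).card : ℝ) * m ^ ((e i).card - T.card) ≤
          (goodColorings e m (X \ (e i \ T))).card := by exact_mod_cast h1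
      rw [div_mul_eq_mul_div, le_div_iff₀ (by positivity)]
      exact h2.trans hle
    have hN0 : 0 ≤ N := by positivity
    calc ((B i T).card : ℝ)
        ≤ ∑ h : ↥(e i \ T) → ↥T,
          (((goodColorings e m X).filter fun c => ∀ x : ↥(e i \ T), c x = c (h x)).card : ℝ) := by
          exact_mod_cast Finset.card_biUnion_le
      _ ≤ ∑ _h : ↥(e i \ T) → ↥T, 2 ^ ((e i).card - T.card - 1) /
          (m : ℝ) ^ ((e i).card - T.card) * N := Finset.sum_le_sum fun h _ => hone h
      _ = (T.card : ℝ) ^ ((e i).card - T.card) * (2 ^ ((e i).card - T.card - 1) /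
          m ^ ((e i).card - T.card)) * N := by
          rw [Finset.sum_const, Finset.card_univ, Fintype.card_fun, Fintype.card_coe,
            Fintype.card_coe, hkcard, nsmul_eq_mul]
          push_cast; ring
      _ ≤ _ := by
          gcongr
          exact representatives_weight_le hm0 (hm i) hTcard (Finset.card_pos.2 ⟨u, hui⟩)
  have hJ : ∀ i ∈ J, (((𝒯 i).biUnion (B i)).card : ℝ) ≤ 32 * (1 / 2) ^ (e i).card / m * N := by
    intro i hi
    have h𝒯 : ((𝒯 i).card : ℝ) ≤ 2 ^ (e i).card := by
      have : (𝒯 i).card ≤ 2 ^ (e i).card :=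
        (Finset.card_filter_le _ _).trans (Finset.card_powerset _).le
      exact_mod_cast this
    have hd : ((e i).card : ℝ) ≤ 2 ^ (e i).card := by
      exact_mod_cast (Nat.lt_two_pow_self).le
    -- At most `2 ^ d` sets `T`, and `d ≤ 2 ^ d`: the decay `(1 / 8) ^ d` leaves `(1 / 2) ^ d`.
    calc (((𝒯 i).biUnion (B i)).card : ℝ) ≤ ∑ T ∈ 𝒯 i, ((B i T).card : ℝ) := by
          exact_mod_cast Finset.card_biUnion_le
      _ ≤ ∑ _T ∈ 𝒯 i, 32 * (e i).card * (1 / 8) ^ (e i).card / m * N :=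
          Finset.sum_le_sum (hB i hi)
      _ = (𝒯 i).card * (32 * (e i).card * (1 / 8) ^ (e i).card / m * N) := by
          rw [Finset.sum_const, nsmul_eq_mul]
      _ ≤ 2 ^ (e i).card * (32 * 2 ^ (e i).card * (1 / 8) ^ (e i).card / m * N) := by gcongr
      _ = 32 * ((2 * 2 * (1 / 8)) ^ (e i).card) / m * N := by
          rw [mul_pow, mul_pow]; ring
      _ = _ := by norm_num
  have hsum : ∑ i ∈ J, (((𝒯 i).biUnion (B i)).card : ℝ) ≤ N / 2 := by
    calc ∑ i ∈ J, (((𝒯 i).biUnion (B i)).card : ℝ)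
        ≤ ∑ i ∈ J, 32 * (1 / 2) ^ (e i).card / m * N := Finset.sum_le_sum hJ
      _ ≤ ∑ i with u ∈ e i, 32 * (1 / 2) ^ (e i).card / m * N := by
          refine Finset.sum_le_sum_of_subset_of_nonneg (fun i hi => ?_) fun _ _ _ => by positivity
          simp only [Finset.mem_filter, Finset.mem_univ, true_and, J] at hi ⊢
          exact hi.1
      _ = (∑ i with u ∈ e i, 32 * (1 / 2 : ℝ) ^ (e i).card) / m * N := by
          rw [Finset.sum_div, Finset.sum_mul]
      _ ≤ (m / 2) / m * N := by gcongr; exact hs u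
      _ = N / 2 := by field_simp
  have hfin : N ≤ (goodColorings e m (insert u X)).card +
      ∑ i ∈ J, (((𝒯 i).biUnion (B i)).card : ℝ) := by
    have h1 := (Finset.card_le_card hsub).trans (Finset.card_union_le _ _)
    have h2 : (J.biUnion fun i => (𝒯 i).biUnion (B i)).card ≤
      ∑ i ∈ J, ((𝒯 i).biUnion (B i)).card := Finset.card_biUnion_le
    rw [hN]
    exact_mod_cast h1.trans (Nat.add_le_add_left h2 _)
  linarith

open Classical in
/-- A local criterion for conflict-free colorability of a hypergraph with `m` colors. -/
theorem exists_coloring_hasUniqueColor [Fintype ι] (e : ι → Finset V) (m : ℕ) (hm0 : 0 < m)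
    (hne : ∀ i, (e i).Nonempty) (hm : ∀ i, 64 * (e i).card ≤ m)
    (hs : ∀ u, ∑ i with u ∈ e i, 32 * (1 / 2 : ℝ) ^ (e i).card ≤ m / 2) :
    ∃ c : V → Fin m, ∀ i, HasUniqueColor c (e i) := by
  have h := card_goodColorings_sdiff_le e m Finset.univ
    (fun Y _ => card_goodColorings_le_two_mul e m hm0 hm hs Y) Finset.univ subset_rfl
  have hpos : 0 < (goodColorings e m (Finset.univ \ Finset.univ)).card := by
    refine Finset.card_pos.2 ⟨fun _ => ⟨0, hm0⟩, mem_goodColorings.2 fun i hi => ?_⟩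
    rw [sdiff_self] at hi
    exact absurd (Finset.subset_empty.1 hi) (hne i).ne_empty
  have hpos' : (0 : ℝ) < (goodColorings e m (Finset.univ : Finset V)).card := by
    by_contra! hle
    have h1 : (0 : ℝ) < (goodColorings e m (Finset.univ \ Finset.univ : Finset V)).card := by
      exact_mod_cast hpos
    have := mul_nonpos_of_nonneg_of_nonpos
      (by positivity : (0 : ℝ) ≤ 2 ^ (Finset.univ : Finset V).card) hle
    linarith
  obtain ⟨c, hc⟩ := Finset.card_pos.1 (by exact_mod_cast hpos')
  exact ⟨c, fun i => mem_goodColorings.1 hc i (Finset.subset_univ _)⟩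

end Counting


/-! ### Coloring digraphs of bounded out-degree -/

/-- A digraph with out-degrees at most `d` is `2 * d`-degenerate, hence `2 * d + 1`-colorable. -/
theorem exists_coloring_of_outDegree_le {V : Type*} [DecidableEq V] (out : V → Finset V) (d : ℕ)
    (U : Finset V) (hd : ∀ u ∈ U, (out u).card ≤ d) :
    ∃ c : V → Fin (2 * d + 1), ∀ u ∈ U, ∀ w ∈ U, w ∈ out u → w ≠ u → c u ≠ c w := by
  induction U using Finset.strongInduction with
  | H U ih =>
  rcases U.eq_empty_or_nonempty with rfl | hU
  · exact ⟨fun _ => 0, by simp⟩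
  -- In-degrees and out-degrees have the same sum, so some in-degree is at most `d`.
  obtain ⟨u, hu, hin⟩ : ∃ u ∈ U, (U.filter fun x => u ∈ out x).card ≤ d := by
    by_contra! hlt
    have h1 : ∑ u ∈ U, (U.filter fun x => u ∈ out x).card =
        ∑ x ∈ U, (U.filter fun u => u ∈ out x).card :=
      Finset.sum_card_bipartiteAbove_eq_sum_card_bipartiteBelow _
    have h2 : ∑ _u ∈ U, d < ∑ u ∈ U, (U.filter fun x => u ∈ out x).card :=
      Finset.sum_lt_sum_of_nonempty hU hlt
    have h3 : ∑ x ∈ U, (U.filter fun u => u ∈ out x).card ≤ ∑ _x ∈ U, d :=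
      Finset.sum_le_sum fun x hx => (Finset.card_le_card fun y hy =>
        (Finset.mem_filter.1 hy).2).trans (hd x hx)
    omega
  obtain ⟨c, hc⟩ := ih (U.erase u) (Finset.erase_ssubset hu)
    fun x hx => hd x (Finset.mem_of_mem_erase hx)
  obtain ⟨i, hi⟩ : ∃ i, i ∉ (out u ∪ U.filter fun x => u ∈ out x).image c := by
    by_contra! hall
    have h1 : (Finset.univ : Finset (Fin (2 * d + 1))).card ≤ _ :=
      Finset.card_le_card fun i _ => hall i
    have h2 := (h1.trans Finset.card_image_le).trans (Finset.card_union_le _ _)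
    have h3 := hd u hu
    rw [Finset.card_univ, Fintype.card_fin] at h2
    omega
  simp only [Finset.mem_image, Finset.mem_union, Finset.mem_filter, not_exists, not_and] at hi
  refine ⟨Function.update c u i, fun x hx w hw hwx hne => ?_⟩
  by_cases hxu : x = u
  · subst hxu
    rw [Function.update_self, Function.update_of_ne hne]
    exact fun h => hi w (Or.inl hwx) h.symm
  · rw [Function.update_of_ne hxu]
    by_cases hwu : w = u
    · subst hwu
      rw [Function.update_self]
      exact hi x (Or.inr ⟨hx, hwx⟩)
    · rw [Function.update_of_ne hwu]
      exact hc x (Finset.mem_erase.2 ⟨hxu, hx⟩) w (Finset.mem_erase.2 ⟨hwu, hw⟩) hwx hne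

/-! ### Neighborhoods in claw-free graphs -/

namespace SimpleGraph

variable {V : Type*} {G : SimpleGraph V}

/-- In a claw-free graph, each independent set contains at most two neighbors of a vertex. -/
theorem IsClawFree.card_filter_adj_le_two [DecidableRel G.Adj] (hG : G.IsClawFree)
    {I : Finset V} (hI : G.IsIndepSet (I : Set V)) (v : V) :
    (I.filter fun w => G.Adj v w).card ≤ 2 := by
  by_contra! hlt
  obtain ⟨f⟩ : Nonempty (Fin 3 ↪ ↥(I.filter fun w => G.Adj v w)) :=
    Function.Embedding.nonempty_of_card_le (by simpa [Nat.succ_le_iff] using hlt)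
  have hf : ∀ i, G.Adj v (f i) := fun i => (Finset.mem_filter.1 (f i).2).2
  have hfI : ∀ i, (f i : V) ∈ I := fun i => (Finset.mem_filter.1 (f i).2).1
  have hff : ∀ i j, ¬ G.Adj (f i) (f j) := by
    intro i j hij
    exact hI (hfI i) (hfI j) hij.ne hij
  refine hG ⟨⟨⟨Sum.elim (fun _ => v) fun i => f i, ?_⟩, ?_⟩⟩
  · rintro (i | i) (j | j) h
    · rw [Subsingleton.elim i j]
    · exact absurd h (hf j).ne
    · exact absurd h.symm (hf i).ne
    · exact congrArg Sum.inr (f.injective (Subtype.ext h))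
  · rintro (i | i) (j | j)
    · change G.Adj v v ↔ _
      simp
    · change G.Adj v (f j) ↔ _
      simpa using hf j
    · change G.Adj (f i) v ↔ _
      simpa using (hf i).symm
    · change G.Adj (f i) (f j) ↔ _
      simpa using hff i j

theorem exists_maximal_indepSet_within [Fintype V] (G : SimpleGraph V) (S : Finset V) :
    ∃ I ⊆ S, G.IsIndepSet (I : Set V) ∧ ∀ v ∈ S, v ∉ I → ∃ w ∈ I, G.Adj v w := by
  classical
  obtain ⟨I, -, hI⟩ := (Set.toFinite
      {I : Finset V | I ⊆ S ∧ G.IsIndepSet (I : Set V)}).exists_le_maximal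
    (a := ∅) (by simp [IsIndepSet])
  refine ⟨I, hI.prop.1, hI.prop.2, fun v hv hvI => ?_⟩
  by_contra! hadj
  refine hvI (hI.le_of_ge (y := insert v I) ⟨?_, ?_⟩ (Finset.subset_insert v I)
    (Finset.mem_insert_self v I))
  · exact Finset.insert_subset hv hI.prop.1
  · rw [Finset.coe_insert, IsIndepSet, Set.pairwise_insert]
    exact ⟨hI.prop.2, fun w hw _ => ⟨hadj w hw, fun h => hadj w hw h.symm⟩⟩

/-- A union of `r` successive maximal independent sets. -/
theorem IsClawFree.exists_layers [Fintype V] [DecidableRel G.Adj] (hG : G.IsClawFree) (r : ℕ) :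
    ∃ A : Finset V, (∀ v ∉ A, r ≤ (A.filter fun w => G.Adj v w).card) ∧
      ∀ v, (A.filter fun w => G.Adj v w).card ≤ 2 * r := by
  classical
  induction r with
  | zero => exact ⟨∅, by simp, by simp⟩
  | succ r ih =>
    obtain ⟨A, hlow, hup⟩ := ih
    obtain ⟨I, hIA, hI, hmax⟩ := G.exists_maximal_indepSet_within Aᶜ
    have hdisj : ∀ v, Disjoint (A.filter fun w => G.Adj v w) (I.filter fun w => G.Adj v w) :=
      fun v => Finset.disjoint_filter_filter
        (Finset.disjoint_right.2 fun x hx => Finset.mem_compl.1 (hIA hx))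
    refine ⟨A ∪ I, fun v hv => ?_, fun v => ?_⟩
    · rw [Finset.notMem_union] at hv
      obtain ⟨w, hw, hvw⟩ := hmax v (Finset.mem_compl.2 hv.1) hv.2
      have h1 : 0 < (I.filter fun w => G.Adj v w).card :=
        Finset.card_pos.2 ⟨w, Finset.mem_filter.2 ⟨hw, hvw⟩⟩
      have h2 := hlow v hv.1
      rw [Finset.filter_union, Finset.card_union_of_disjoint (hdisj v)]
      omega
    · have h1 := hG.card_filter_adj_le_two hI v
      have h2 := hup v
      rw [Finset.filter_union, Finset.card_union_of_disjoint (hdisj v)]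
      omega

/-- If the vertices of `U` have at most `d` neighbors in `S` each, then `2 * d + 1` colors on `U`
suffice to give each vertex of `S` with a neighbor in `U` a unique color. -/
theorem exists_coloring_serving [Fintype V] [DecidableRel G.Adj] (U S : Finset V) (d : ℕ)
    (hd : ∀ u ∈ U, (S.filter fun v => G.Adj u v).card ≤ d)
    (hS : ∀ v ∈ S, ∃ u ∈ U, G.Adj v u) :
    ∃ c : V → Fin (2 * d + 1), ∀ v ∈ S, HasUniqueColor c (U.filter fun u => G.Adj v u) := by
  classical
  choose! f hfU hf using hS
  -- Fix a server `f v ∈ U` for each `v ∈ S`. Arcs from `u` to the servers of its neighbors in `S`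
  -- make the color of `f v` differ from those of all other neighbors of `v` in `U`.
  obtain ⟨c, hc⟩ := exists_coloring_of_outDegree_le
    (fun u => (S.filter fun v => G.Adj u v).image f) d U
    fun u hu => Finset.card_image_le.trans (hd u hu)
  refine ⟨c, fun v hv => ⟨c (f v), f v, ⟨Finset.mem_filter.2 ⟨hfU v hv, hf v hv⟩, rfl⟩, ?_⟩⟩
  rintro u ⟨hu, huc⟩
  rw [Finset.mem_filter] at hu
  by_contra hne
  exact hc u hu.1 (f v) (hfU v hv) (Finset.mem_image_of_mem f
    (Finset.mem_filter.2 ⟨hv, hu.2.symm⟩)) (Ne.symm hne) huc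

/-- Colorings of two complementary sets of vertices with separate palettes can be combined. -/
theorem existsUnique_sumElim {α β : Type*} [Fintype V] [DecidableEq V] [DecidableRel G.Adj]
    (A : Finset V) (a : V → α) (b : V → β) (v : V)
    (h : HasUniqueColor a (A.filter fun w => G.Adj v w) ∨
      HasUniqueColor b (Aᶜ.filter fun w => G.Adj v w)) :
    ∃ i : α ⊕ β, ∃! w, w ∈ G.neighborSet v ∧ (if w ∈ A then .inl (a w) else .inr (b w)) = i := by
  rcases h with ⟨i, w, ⟨hw, hwi⟩, huniq⟩ | ⟨i, w, ⟨hw, hwi⟩, huniq⟩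
  · rw [Finset.mem_filter] at hw
    refine ⟨.inl i, w, ⟨hw.2, by simp [hw.1, hwi]⟩, fun y hy => ?_⟩
    obtain ⟨hy1, hy2⟩ := hy
    by_cases hyA : y ∈ A
    · exact huniq y ⟨Finset.mem_filter.2 ⟨hyA, hy1⟩, by simpa [hyA] using hy2⟩
    · simp [hyA] at hy2
  · rw [Finset.mem_filter, Finset.mem_compl] at hw
    refine ⟨.inr i, w, ⟨hw.2, by simp [hw.1, hwi]⟩, fun y hy => ?_⟩
    obtain ⟨hy1, hy2⟩ := hy
    by_cases hyA : y ∈ A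
    · simp [hyA] at hy2
    · exact huniq y ⟨Finset.mem_filter.2 ⟨Finset.mem_compl.2 hyA, hy1⟩, by simpa [hyA] using hy2⟩

/-- A conflict-free coloring of the open neighborhoods of all vertices that are not isolated. -/
theorem IsClawFree.exists_coloring_of_maxDegree_le [Fintype V] [DecidableRel G.Adj]
    (hG : G.IsClawFree) {r : ℕ} (hr : 0 < r) (hΔ : G.maxDegree ≤ 2 ^ r) :
    ∃ c : V → Fin (133 * r), ∀ v, ¬ G.IsIsolated v →
      ∃ i, ∃! w, w ∈ G.neighborSet v ∧ c w = i := by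
  classical
  obtain ⟨A, hlow, hup⟩ := hG.exists_layers r
  let S : Finset V := A.filter fun v => ∃ u ∈ Aᶜ, G.Adj v u
  obtain ⟨b, hb⟩ := G.exists_coloring_serving Aᶜ S (2 * r)
    (fun u _ => (Finset.card_le_card (Finset.filter_subset_filter _
      (Finset.filter_subset _ _))).trans (hup u))
    fun v hv => (Finset.mem_filter.1 hv).2
  let e : {v : V // v ∉ S ∧ ¬ G.IsIsolated v} → Finset V := fun v => A.filter fun w => G.Adj v w
  -- `128 * r` is `64` times the maximal edge size `2 * r`.
  obtain ⟨a, ha⟩ := exists_coloring_hasUniqueColor e (128 * r) (by omega)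
    (by
      rintro ⟨v, hvS, hv⟩
      by_cases hvA : v ∈ A
      · simp only [IsIsolated, not_forall, not_not] at hv
        obtain ⟨w, hw⟩ := hv
        refine ⟨w, Finset.mem_filter.2 ⟨?_, hw⟩⟩
        by_contra hwA
        exact hvS (Finset.mem_filter.2 ⟨hvA, w, Finset.mem_compl.2 hwA, hw⟩)
      · exact Finset.card_pos.1 (hr.trans_le (hlow v hvA)))
    (fun v => by have := hup v; simp only [e]; omega)
    (by
      intro u
      have hterm : ∀ v : {v : V // v ∉ S ∧ ¬ G.IsIsolated v}, u ∈ e v →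
          32 * (1 / 2 : ℝ) ^ (e v).card ≤
            (if v.1 ∈ A then 16 else 32 * (1 / 2 : ℝ) ^ r) := by
        intro v hv
        split_ifs with hvA
        · have h1 : 1 ≤ (e v).card := Finset.card_pos.2 ⟨u, hv⟩
          have := pow_le_pow_of_le_one (by norm_num : (0 : ℝ) ≤ 1 / 2) (by norm_num) h1
          linarith
        · have := pow_le_pow_of_le_one (by norm_num : (0 : ℝ) ≤ 1 / 2) (by norm_num)
            (hlow v hvA)
          simp only [e]
          linarith
      have hdeg : ((G.neighborFinset u).card : ℝ) ≤ 2 ^ r := by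
        exact_mod_cast ((G.card_neighborFinset_eq_degree u).le.trans
          (G.degree_le_maxDegree u)).trans hΔ
      have hupu : ((A.filter fun w => G.Adj u w).card : ℝ) ≤ 2 * r := by exact_mod_cast hup u
      calc ∑ v with u ∈ e v, 32 * (1 / 2 : ℝ) ^ (e v).card
          ≤ ∑ v with u ∈ e v, (if v.1 ∈ A then 16 else 32 * (1 / 2 : ℝ) ^ r) :=
            Finset.sum_le_sum fun v hv => hterm v (Finset.mem_filter.1 hv).2
        _ = ∑ v ∈ (Finset.univ.filter fun v => u ∈ e v).image Subtype.val,
              (if v ∈ A then 16 else 32 * (1 / 2 : ℝ) ^ r) :=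
            (Finset.sum_image (f := fun v => if v ∈ A then 16 else 32 * (1 / 2 : ℝ) ^ r)
              fun _ _ _ _ h => Subtype.ext h).symm
        _ ≤ ∑ v ∈ G.neighborFinset u, (if v ∈ A then 16 else 32 * (1 / 2 : ℝ) ^ r) := by
            refine Finset.sum_le_sum_of_subset_of_nonneg ?_ fun _ _ _ => by positivity
            intro v hv
            obtain ⟨v, hve, rfl⟩ := Finset.mem_image.1 hv
            have hadj := (Finset.mem_filter.1 (Finset.mem_filter.1 hve).2).2
            exact (G.mem_neighborFinset u v).2 hadj.symm
        _ ≤ ∑ v ∈ G.neighborFinset u, ((if v ∈ A then 16 else 0) + 32 * (1 / 2 : ℝ) ^ r) := by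
            refine Finset.sum_le_sum fun v _ => ?_
            split_ifs
            · exact le_add_of_nonneg_right (by positivity)
            · simp
        _ = 16 * (A.filter fun w => G.Adj u w).card +
              32 * ((G.neighborFinset u).card * (1 / 2 : ℝ) ^ r) := by
            have : (G.neighborFinset u).filter (· ∈ A) = A.filter fun w => G.Adj u w := by
              ext x; simp [and_comm]
            rw [Finset.sum_add_distrib, ← Finset.sum_filter, this]
            simp only [Finset.sum_const, nsmul_eq_mul]
            ring
        _ ≤ 16 * (2 * r) + 32 * (2 ^ r * (1 / 2 : ℝ) ^ r) := by gcongr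
        _ = 32 * r + 32 := by
            rw [← mul_pow]; norm_num; ring
        _ ≤ (128 * r : ℕ) / 2 := by
            have : (1 : ℝ) ≤ r := by exact_mod_cast hr
            push_cast; linarith)
  -- `128r + 4r + 1 ≤ 133r` since `r ≥ 1`.
  obtain ⟨φ⟩ : Nonempty (Fin (128 * r) ⊕ Fin (2 * (2 * r) + 1) ↪ Fin (133 * r)) :=
    Function.Embedding.nonempty_of_card_le (by simp; omega)
  refine ⟨fun w => φ (if w ∈ A then .inl (a w) else .inr (b w)), fun v hv => ?_⟩
  obtain ⟨i, hi⟩ := G.existsUnique_sumElim A a b v (by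
    by_cases hvS : v ∈ S
    · exact Or.inr (hb v hvS)
    · exact Or.inl (ha ⟨v, hvS, hv⟩))
  exact ⟨φ i, by simpa only [φ.injective.eq_iff] using hi⟩

/-- Doubling the number of colors turns a coloring that is conflict-free on open neighborhoods
into one that is conflict-free on closed neighborhoods; isolated vertices do no harm. -/
theorem exists_isCFCNColoring_prod_bool [Finite V] {α : Type*} (c : V → α)
    (hc : ∀ v, ¬ G.IsIsolated v → ∃ i, ∃! w, w ∈ G.neighborSet v ∧ c w = i) :
    ∃ b : V → Bool, G.IsCFCNColoring fun v => (c v, b v) := by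
  classical
  obtain ⟨n, ⟨φ⟩⟩ := Finite.exists_equiv_fin V
  have hc' : ∀ v, ¬ G.IsIsolated v → ∃ w, G.Adj v w ∧ ∀ y, G.Adj v y → c y = c w → y = w := by
    intro v hv
    obtain ⟨i, w, ⟨hw, rfl⟩, huniq⟩ := hc v hv
    exact ⟨w, hw, fun y hy hyw => huniq y ⟨hy, hyw⟩⟩
  choose! f hf hfu using hc'
  -- The color of `f v` can be repeated in the closed neighborhood only by `v` itself. The bit must
  -- separate `v` from `f v` when `v` is bad; if `f v` is bad too, then `f (f v) = v`, and the order
  -- `φ` breaks the tie.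
  let bad : V → Prop := fun v => ¬ G.IsIsolated v ∧ c v = c (f v)
  refine ⟨fun v => decide (bad v ∧ (bad (f v) → φ v < φ (f v))), fun v => ?_⟩
  by_cases hv : G.IsIsolated v
  · refine ⟨_, v, ⟨Set.mem_insert _ _, rfl⟩, fun y hy => ?_⟩
    exact hy.1.resolve_right (hv y)
  refine ⟨_, f v, ⟨Set.mem_insert_of_mem _ (hf v hv), rfl⟩, ?_⟩
  rintro y ⟨hy, hyc⟩
  obtain ⟨hyc, hyb⟩ := Prod.mk.injEq .. ▸ hyc
  rcases hy with rfl | hy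
  · exfalso
    have hbad : bad y := ⟨hv, hyc⟩
    have hback : bad (f y) → f (f y) = y := fun h =>
      (hfu (f y) h.1 y (hf y hv).symm (hyc.trans h.2)).symm
    rw [decide_eq_decide] at hyb
    by_cases hfb : bad (f y)
    · have hne : φ y ≠ φ (f y) := φ.injective.ne (hf y hv).ne
      simp only [hbad, hfb, hback hfb, true_and, forall_true_left] at hyb
      rcases lt_or_gt_of_ne hne with h | h
      · exact lt_asymm h (hyb.1 h)
      · exact lt_asymm h (hyb.2 h)
    · simp [hbad, hfb] at hyb
  · exact hfu v hv y hy hyc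

theorem cfonChromaticNumber_le {r : ℕ} (c : V → Fin r) (hc : G.IsCFONColoring c) :
    G.cfonChromaticNumber ≤ r :=
  iInf₂_le r ⟨c, hc⟩

theorem cfcnChromaticNumber_le {r : ℕ} (c : V → Fin r) (hc : G.IsCFCNColoring c) :
    G.cfcnChromaticNumber ≤ r :=
  iInf₂_le r ⟨c, hc⟩

end SimpleGraph

theorem natLog_add_one_le (n : ℕ) (hn : 2 ≤ n) :
    ((Nat.log 2 n + 1 : ℕ) : ℝ) ≤ 2 / Real.log 2 * Real.log n := by
  have h1 : ((Nat.log 2 n : ℕ) : ℝ) ≤ Real.logb 2 n := by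
    exact_mod_cast Real.natLog_le_logb n 2
  have h2 : (1 : ℝ) ≤ Real.logb 2 n := by
    rw [Real.le_logb_iff_rpow_le (by norm_num) (by positivity)]
    simpa using (by exact_mod_cast hn : (2 : ℝ) ≤ n)
  have h3 : 2 / Real.log 2 * Real.log n = 2 * Real.logb 2 n := by
    rw [Real.logb]; ring
  push_cast
  linarith

theorem toENNReal_le_ofReal {x : ℕ∞} {n : ℕ} {y : ℝ} (hx : x ≤ n) (hn : (n : ℝ) ≤ y) :
    (x : ℝ≥0∞) ≤ ENNReal.ofReal y := by
  have h1 : (x : ℝ≥0∞) ≤ ((n : ℕ∞) : ℝ≥0∞) := by exact_mod_cast hx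
  refine h1.trans ?_
  rw [ENat.toENNReal_coe, ← ENNReal.ofReal_natCast]
  exact ENNReal.ofReal_le_ofReal hn

theorem corollary4 :
    ∃ C : ℝ, 0 < C ∧
      ∀ (V : Type*) [Fintype V] (G : SimpleGraph V) [DecidableRel G.Adj],
        G.IsClawFree → 2 ≤ G.maxDegree →
          (G.cfcnChromaticNumber : ℝ≥0∞) ≤ ENNReal.ofReal (C * Real.log G.maxDegree) ∧
          ((∀ v : V, ¬ G.IsIsolated v) →
            (G.cfonChromaticNumber : ℝ≥0∞) ≤ ENNReal.ofReal (C * Real.log G.maxDegree)) := by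
  -- `266 = 2 * 133` accounts for the extra bit; `2 / log 2` comes from `log₂ Δ + 1 ≤ 2 log₂ Δ`.
  refine ⟨266 * (2 / Real.log 2), by have := Real.log_pos one_lt_two; positivity, ?_⟩
  intro V _ G _ hG hΔ
  set r := Nat.log 2 G.maxDegree + 1 with hr
  obtain ⟨c, hc⟩ := hG.exists_coloring_of_maxDegree_le (r := r) (by omega)
    (Nat.lt_pow_succ_log_self one_lt_two _).le
  have hlog : (r : ℝ) ≤ 2 / Real.log 2 * Real.log G.maxDegree := natLog_add_one_le _ hΔ
  constructor
  · obtain ⟨b, hb⟩ := G.exists_isCFCNColoring_prod_bool c hc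
    obtain ⟨φ⟩ : Nonempty (Fin (133 * r) × Bool ≃ Fin (266 * r)) :=
      ⟨Fintype.equivFinOfCardEq (by simp; omega)⟩
    refine toENNReal_le_ofReal (G.cfcnChromaticNumber_le (fun v => φ (c v, b v)) fun v => ?_)
      (by push_cast; linarith)
    obtain ⟨i, hi⟩ := hb v
    exact ⟨φ i, by simpa only [φ.injective.eq_iff] using hi⟩
  · intro hiso
    refine toENNReal_le_ofReal (G.cfonChromaticNumber_le c fun v => hc v (hiso v)) ?_
    have : (0 : ℝ) ≤ r := by positivity
    push_cast
    linarith
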